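/- Let $\mathbf{O}_3=\langle\{0,\tfrac12,1\};\land,\lor,\to,\neg\rangle$ be the three-element algebra with the following operations: $\tfrac12\land x=x\land\tfrac12=x$ for all $x$, $1\land 1=1$, and $0\land x=x\land 0=0$ for all $x$; $\tfrac12\lor x=x\lor\tfrac12=x$ for all $x$, $0\lor 0=0$, and $1\lor x=x\lor 1=1$ for all $x$; $\tfrac12\to x=1\to x=x$ and $0\to x=\tfrac12$ for all $x$; $\neg 0=1$, $\neg 1=0$, $\neg\tfrac12=\tfrac12$. All algebras are non-empty. Let $V(\mathbf{O}_3)$ be the variety generated by $\mathbf{O}_3$ (the smallest class of algebras that contains $\mathbf{O}_3$ and is closed under homomorphic images, subalgebras and direct products), and let $\mathbb{OL}$ be the quasivariety generated by $\mathbf{O}_3$ (the smallest class of algebras that contains $\mathbf{O}_3$ and the one-element algebras and is closed under isomorphic copies, subalgebras and reduced products). Theorem. 1. $V(\mathbf{O}_3)$ is an arithmetical variety: for every $\mathbf{A}\in V(\mathbf{O}_3)$ the congruence lattice of $\mathbf{A}$ is distributive, and $\theta\circ\varphi=\varphi\circ\theta$ for all congruences $\theta,\varphi$ of $\mathbf{A}$.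 2. $V(\mathbf{O}_3)=\mathbb{OL}$. 3. $\mathbf{O}_3$ is quasi-primal, that is, it is finite and has a discriminator term: a ternary term $t$ in the language of $\mathbf{O}_3$ with $t(a,b,c)=c$ if $a=b$ and $t(a,b,c)=a$ if $a\neq b$, for all $a,b,c\in\mathbf{O}_3$. Consequently $\mathbb{OL}$ is a discriminator variety, that is, it is the variety generated by some class of algebras that have a common discriminator term. 4. For each $c\in\{0,1\}$, the expansion of $\mathbf{O}_3$ by a constant symbol denoting $c$ is a primal algebra: it is finite, and for every $n\geq 1$ every $n$-ary function on $\{0,\tfrac12,1\}$ is represented by a term. -/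

import Mathlib

universe u

namespace OrdinaryDiscourse

open FirstOrder FirstOrder.Language

/-! ### Algebras over an algebraic (relation-free) language, and classes of algebras -/

/-- An algebra of type `L`: a nonempty set together with an interpretation of the operation
symbols of the language `L` (which is meant to have no relation symbols). -/
structure Alg (L : FirstOrder.Language.{0, 0}) where
  carrier : Type u
  [str : L.Structure carrier]
  [nonempty : Nonempty carrier]

attribute [instance] Alg.str Alg.nonempty

/-- The direct product of a family of algebras, with componentwise operations. -/
instance piStructure {L : FirstOrder.Language.{0, 0}} {ι : Type u} (A : ι → Alg.{u} L) :
    L.Structure (∀ i, (A i).carrier) where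
  funMap f x := fun i => Structure.funMap f (fun k => x k i)
  RelMap r x := ∀ i, Structure.RelMap r (fun k => x k i)

/-- The direct product as an algebra. -/
def Alg.pi {L : FirstOrder.Language.{0, 0}} {ι : Type u} (A : ι → Alg.{u} L) : Alg.{u} L where
  carrier := ∀ i, (A i).carrier

/-- The operations of the direct product respect the relation
`x ∼ y ↔ {i | x i = y i} ∈ F`, for every filter `F` on the index set. -/
@[reducible]
def reducedPrestructure {L : FirstOrder.Language.{0, 0}} [L.IsAlgebraic] {ι : Type u} (F : Filter ι)
    (A : ι → Alg.{u} L) : L.Prestructure (F.productSetoid (fun i => (A i).carrier)) where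
  toStructure := piStructure A
  fun_equiv := by
    intro n f x y h
    have h' : ∀ᶠ i in F, ∀ k, x k i = y k i := Filter.eventually_all.2 (fun k => h k)
    exact h'.mono (fun i hi => congrArg (Structure.funMap f) (funext hi))
  rel_equiv := by
    intro n r
    exact isEmptyElim r

/-- The reduced product of the family `A` by the filter `F`. -/
def Alg.reducedProduct {L : FirstOrder.Language.{0, 0}} [L.IsAlgebraic] {ι : Type u} (F : Filter ι)
    (A : ι → Alg.{u} L) : Alg.{u} L where
  carrier := Quotient (F.productSetoid (fun i => (A i).carrier))
  str := @quotientStructure L _ _ (reducedPrestructure F A)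
  nonempty := ⟨Quotient.mk _ (fun _ => Classical.arbitrary _)⟩

/-- The subalgebra of `A` on a nonempty subuniverse `S`, as an algebra. -/
def Alg.sub {L : FirstOrder.Language.{0, 0}} (A : Alg.{u} L) (S : L.Substructure A.carrier)
    (hS : (S : Set A.carrier).Nonempty) : Alg.{u} L where
  carrier := S
  nonempty := hS.to_subtype

/-- A variety: a nonempty class of algebras closed under homomorphic images, subalgebras and
direct products. -/
structure IsVariety {L : FirstOrder.Language.{0, 0}} (𝒱 : Set (Alg.{u} L)) : Prop where
  nonempty : 𝒱.Nonempty
  image : ∀ A ∈ 𝒱, ∀ (B : Alg.{u} L) (f : A.carrier →[L] B.carrier),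
    Function.Surjective f → B ∈ 𝒱
  sub : ∀ A ∈ 𝒱, ∀ (S : L.Substructure A.carrier) (hS : (S : Set A.carrier).Nonempty),
    A.sub S hS ∈ 𝒱
  pi : ∀ (ι : Type u) (A : ι → Alg.{u} L), (∀ i, A i ∈ 𝒱) → Alg.pi A ∈ 𝒱

/-- A quasivariety: a class of algebras closed under isomorphisms, subalgebras and reduced
products, and containing the one-element algebras. -/
structure IsQuasivariety {L : FirstOrder.Language.{0, 0}} [L.IsAlgebraic] (𝒬 : Set (Alg.{u} L)) :
    Prop where
  trivial : ∀ A : Alg.{u} L, Subsingleton A.carrier → A ∈ 𝒬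
  iso : ∀ A ∈ 𝒬, ∀ B : Alg.{u} L, Nonempty (A.carrier ≃[L] B.carrier) → B ∈ 𝒬
  sub : ∀ A ∈ 𝒬, ∀ (S : L.Substructure A.carrier) (hS : (S : Set A.carrier).Nonempty),
    A.sub S hS ∈ 𝒬
  reducedProduct : ∀ (ι : Type u) (F : Filter ι) (A : ι → Alg.{u} L), (∀ i, A i ∈ 𝒬) →
    Alg.reducedProduct F A ∈ 𝒬

/-- The variety generated by `K`: the smallest variety containing `K`. -/
def varietyGen {L : FirstOrder.Language.{0, 0}} (K : Set (Alg.{u} L)) : Set (Alg.{u} L) :=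
  {A | ∀ 𝒱 : Set (Alg.{u} L), IsVariety 𝒱 → K ⊆ 𝒱 → A ∈ 𝒱}

/-- The quasivariety generated by `K`: the smallest quasivariety containing `K`. -/
def quasivarietyGen {L : FirstOrder.Language.{0, 0}} [L.IsAlgebraic] (K : Set (Alg.{u} L)) :
    Set (Alg.{u} L) :=
  {A | ∀ 𝒬 : Set (Alg.{u} L), IsQuasivariety 𝒬 → K ⊆ 𝒬 → A ∈ 𝒬}

/-! ### Congruences -/

/-- A congruence of the algebra `A`: an equivalence relation compatible with all operations. -/
@[ext]
structure Congruence (L : FirstOrder.Language.{0, 0}) (A : Type u) [L.Structure A] where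
  rel : A → A → Prop
  equivalence : Equivalence rel
  compatible : ∀ {n : ℕ} (f : L.Functions n) (x y : Fin n → A), (∀ i, rel (x i) (y i)) →
    rel (Structure.funMap f x) (Structure.funMap f y)

namespace Congruence

variable {L : FirstOrder.Language.{0, 0}} {A : Type u} [L.Structure A]

/-- Congruences are ordered by inclusion. -/
instance : PartialOrder (Congruence L A) where
  le θ φ := ∀ a b, θ.rel a b → φ.rel a b
  le_refl _ _ _ h := h
  le_trans _ _ _ h₁ h₂ a b h := h₂ a b (h₁ a b h)
  le_antisymm θ φ h₁ h₂ := by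
    ext a b
    exact ⟨h₁ a b, h₂ a b⟩

/-- The infimum of a set of congruences is their intersection. -/
instance : InfSet (Congruence L A) where
  sInf T :=
    { rel := fun a b => ∀ θ ∈ T, θ.rel a b
      equivalence :=
        ⟨fun a θ _ => θ.equivalence.refl a, fun h θ hθ => θ.equivalence.symm (h θ hθ),
          fun h₁ h₂ θ hθ => θ.equivalence.trans (h₁ θ hθ) (h₂ θ hθ)⟩
      compatible := fun f x y h θ hθ => θ.compatible f x y (fun i => h i θ hθ) }

/-- The lattice of congruences; the meet is the intersection and the join of `θ` and `φ` is the
smallest congruence that contains both. -/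
instance : CompleteLattice (Congruence L A) where
  __ := completeLatticeOfInf (Congruence L A) (fun _ =>
    ⟨fun θ hθ _ _ h => h θ hθ, fun _ hψ a b h _ hθ => hψ hθ a b h⟩)
  inf θ φ :=
    { rel := fun a b => θ.rel a b ∧ φ.rel a b
      equivalence :=
        ⟨fun a => ⟨θ.equivalence.refl a, φ.equivalence.refl a⟩,
          fun h => ⟨θ.equivalence.symm h.1, φ.equivalence.symm h.2⟩,
          fun h₁ h₂ => ⟨θ.equivalence.trans h₁.1 h₂.1, φ.equivalence.trans h₁.2 h₂.2⟩⟩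
      compatible := fun f x y h => ⟨θ.compatible f x y (fun i => (h i).1),
        φ.compatible f x y (fun i => (h i).2)⟩ }
  inf_le_left _ _ _ _ h := h.1
  inf_le_right _ _ _ _ h := h.2
  le_inf _ _ _ h₁ h₂ a b h := ⟨h₁ a b h, h₂ a b h⟩

end Congruence

/-- A class of algebras is congruence-distributive if the congruence lattice of each of its
members is distributive. -/
def IsCongruenceDistributive {L : FirstOrder.Language.{0, 0}} (𝒱 : Set (Alg.{u} L)) : Prop :=
  ∀ A ∈ 𝒱, ∀ θ φ ψ : Congruence L A.carrier, θ ⊓ (φ ⊔ ψ) = (θ ⊓ φ) ⊔ (θ ⊓ ψ)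

/-- A class of algebras is congruence-permutable if `θ ∘ φ = φ ∘ θ` for all congruences `θ`, `φ`
of each of its members. -/
def IsCongruencePermutable {L : FirstOrder.Language.{0, 0}} (𝒱 : Set (Alg.{u} L)) : Prop :=
  ∀ A ∈ 𝒱, ∀ θ φ : Congruence L A.carrier,
    Relation.Comp θ.rel φ.rel = Relation.Comp φ.rel θ.rel

/-- An arithmetical variety. -/
def IsArithmetical {L : FirstOrder.Language.{0, 0}} (𝒱 : Set (Alg.{u} L)) : Prop :=
  IsVariety 𝒱 ∧ IsCongruenceDistributive 𝒱 ∧ IsCongruencePermutable 𝒱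

/-! ### Discriminator terms, quasi-primal and primal algebras -/

/-- The ternary term `t` represents on `A` the discriminator function, whose value at `(a, b, c)`
is `c` if `a = b`, and `a` otherwise. -/
def IsDiscriminatorTerm {L : FirstOrder.Language.{0, 0}} (A : Alg.{u} L)
    (t : L.Term (Fin 3)) : Prop :=
  ∀ a b c : A.carrier, (a = b → t.realize ![a, b, c] = c) ∧ (a ≠ b → t.realize ![a, b, c] = a)

/-- A quasi-primal algebra: a finite algebra with a discriminator term. -/
def IsQuasiprimal {L : FirstOrder.Language.{0, 0}} (A : Alg.{u} L) : Prop :=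
  Finite A.carrier ∧ ∃ t : L.Term (Fin 3), IsDiscriminatorTerm A t

/-- A discriminator variety: the variety generated by a class of algebras that have a common
discriminator term. -/
def IsDiscriminatorVariety {L : FirstOrder.Language.{0, 0}} (𝒱 : Set (Alg.{u} L)) : Prop :=
  ∃ (K : Set (Alg.{u} L)) (t : L.Term (Fin 3)),
    (∀ A ∈ K, IsDiscriminatorTerm A t) ∧ 𝒱 = varietyGen K

/-- A primal algebra: a finite algebra on which every `n`-ary function, for every `n ≥ 1`, is
represented by a term. -/
def IsPrimal {L : FirstOrder.Language.{0, 0}} (A : Alg.{u} L) : Prop :=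
  Finite A.carrier ∧ ∀ n : ℕ, 1 ≤ n → ∀ f : (Fin n → A.carrier) → A.carrier,
    ∃ t : L.Term (Fin n), ∀ x : Fin n → A.carrier, t.realize x = f x

/-! ### The three-element algebra `O₃` -/

/-- The operation symbols `∧`, `∨`, `→` (binary) and `¬` (unary). -/
inductive OLOp : ℕ → Type
  | and : OLOp 2
  | or : OLOp 2
  | imp : OLOp 2
  | neg : OLOp 1

/-- The algebraic language `{∧, ∨, →, ¬}`. -/
def olLang : FirstOrder.Language.{0, 0} := ⟨OLOp, fun _ => Empty⟩

instance : olLang.IsAlgebraic := fun _ => inferInstanceAs (IsEmpty Empty)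

/-- The three truth values `0`, `1/2`, `1`. -/
inductive O3 : Type u
  | zero
  | half
  | one

namespace O3

/-- Conjunction: `1/2` is neutral, `0` is absorbing. -/
def and : O3.{u} → O3.{u} → O3.{u}
  | half, y => y
  | one, half => one
  | one, one => one
  | one, zero => zero
  | zero, _ => zero

/-- Disjunction: `1/2` is neutral, `1` is absorbing. -/
def or : O3.{u} → O3.{u} → O3.{u}
  | half, y => y
  | one, _ => one
  | zero, half => zero
  | zero, one => one
  | zero, zero => zero

/-- Implication: `1/2 → y = 1 → y = y` and `0 → y = 1/2`. -/
def imp : O3.{u} → O3.{u} → O3.{u}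
  | half, y => y
  | one, y => y
  | zero, _ => half

/-- Negation: exchanges `0` and `1` and fixes `1/2`. -/
def neg : O3.{u} → O3.{u}
  | half => half
  | one => zero
  | zero => one

instance : Nonempty O3.{u} := ⟨half⟩

/-- The algebra `O₃ = ⟨{0, 1/2, 1}; ∧, ∨, →, ¬⟩`. -/
instance : olLang.Structure O3.{u} where
  funMap {_} f := match f with
    | OLOp.and => fun x => and (x 0) (x 1)
    | OLOp.or => fun x => or (x 0) (x 1)
    | OLOp.imp => fun x => imp (x 0) (x 1)
    | OLOp.neg => fun x => neg (x 0)
  RelMap r := Empty.elim r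

end O3

/-- `O₃` as a bundled algebra. -/
def algO3 : Alg.{u} olLang where
  carrier := O3.{u}

/-- The expansion of `O₃` by one new constant symbol, interpreted as `c`. -/
def algO3WithConstant (c : O3.{u}) : Alg.{u} (olLang[[Unit]]) where
  carrier := O3.{u}
  str :=
    letI : (constantsOn Unit).Structure O3.{u} := constantsOn.structure (fun _ => c)
    olLang.withConstantsStructure Unit

/-- The variety `V(O₃)` generated by `O₃`. -/
def varietyO3 : Set (Alg.{u} olLang) := varietyGen {algO3}

/-- The class `𝕆𝕃`: the quasivariety generated by `O₃`. -/
def OL : Set (Alg.{u} olLang) := quasivarietyGen {algO3}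

end OrdinaryDiscourse

/-! Everything rests on the discriminator. Since `1/2` is neutral for `∧`, terms with value `y` on
one truth value and `1/2` elsewhere can be joined by conjunction into a definition by cases; this
yields `disc` and from it `switch` ("if x = y then z else w").

Let `separatedClass` consist of the algebras whose homomorphisms into `O₃` separate points, that is,
those embeddable in powers of `O₃`. Identities of `O₃` hold there, so the discriminator term
satisfies Pixley's identities and gives arithmeticity. Closure under subalgebras and products is
immediate; the crux is closure under images (`mem_separatedClass_of_surjective`). For `f : A → B`
onto, `switch` makes the equalizers of pairs in the kernel of `f` a base of a filter on the
homomorphisms `A → O₃`, and this filter recovers the kernel. If `f a ≠ f b`, an ultrafilter above it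
avoids the equalizer of `a` and `b`; as `O₃` is finite, the limit homomorphism exists, factors
through `f` and separates `f a` from `f b`. Hence the class is both a variety and a quasivariety,
and equals both generated classes.

For primality, a constant `0` or `1` yields all three constants, and `switch` then interpolates any
function by induction on arity. -/

namespace OrdinaryDiscourse

open FirstOrder FirstOrder.Language

/-! ### Congruences and terms -/

namespace Congruence

variable {L : FirstOrder.Language.{0, 0}} {A : Type u} [L.Structure A]

/-- Congruences are compatible with all term operations. -/
theorem realize_term (θ : Congruence L A) {α : Type*} (t : L.Term α) (v w : α → A)
    (h : ∀ i, θ.rel (v i) (w i)) : θ.rel (t.realize v) (t.realize w) := by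
  induction t with
  | var i => exact h i
  | func f ts ih => exact θ.compatible f _ _ ih

theorem realize_term_three (θ : Congruence L A) (t : L.Term (Fin 3)) {a b c a' b' c' : A}
    (ha : θ.rel a a') (hb : θ.rel b b') (hc : θ.rel c c') :
    θ.rel (t.realize ![a, b, c]) (t.realize ![a', b', c']) := by
  refine θ.realize_term t _ _ fun i => ?_
  fin_cases i
  exacts [ha, hb, hc]

/-- The relational product of two permuting congruences, as a congruence. -/
def comp (θ φ : Congruence L A)
    (h : Relation.Comp θ.rel φ.rel = Relation.Comp φ.rel θ.rel) : Congruence L A where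
  rel := Relation.Comp θ.rel φ.rel
  equivalence :=
    { refl := fun a => ⟨a, θ.equivalence.refl a, φ.equivalence.refl a⟩
      symm := by
        rintro a b ⟨c, hac, hcb⟩
        rw [h]
        exact ⟨c, φ.equivalence.symm hcb, θ.equivalence.symm hac⟩
      trans := by
        rintro a b c ⟨d, had, hdb⟩ ⟨e, hbe, hec⟩
        -- Swapping the two middle factors lets the outer steps merge by transitivity.
        have hde : Relation.Comp φ.rel θ.rel d e := ⟨b, hdb, hbe⟩
        rw [← h] at hde
        obtain ⟨m, hdm, hme⟩ := hde
        exact ⟨m, θ.equivalence.trans had hdm, φ.equivalence.trans hme hec⟩ }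
  compatible := by
    intro n f x y hxy
    choose z hxz hzy using hxy
    exact ⟨Structure.funMap f z, θ.compatible f _ _ hxz, φ.compatible f _ _ hzy⟩

theorem sup_le_comp (θ φ : Congruence L A)
    (h : Relation.Comp θ.rel φ.rel = Relation.Comp φ.rel θ.rel) : θ ⊔ φ ≤ comp θ φ h :=
  sup_le (fun _ b hab => ⟨b, hab, φ.equivalence.refl b⟩)
    (fun a _ hab => ⟨a, θ.equivalence.refl a, hab⟩)

end Congruence

/-- A ternary term satisfying Pixley's identities, which characterize arithmetical varieties. -/
structure IsPixleyTerm {L : FirstOrder.Language.{0, 0}} (t : L.Term (Fin 3)) (A : Type u)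
    [L.Structure A] : Prop where
  left : ∀ a c : A, t.realize ![a, a, c] = c
  right : ∀ a b : A, t.realize ![a, b, b] = a
  outer : ∀ a b : A, t.realize ![a, b, a] = a

namespace IsPixleyTerm

variable {L : FirstOrder.Language.{0, 0}} {t : L.Term (Fin 3)} {A : Type u} [L.Structure A]

theorem comp_le (ht : IsPixleyTerm t A) (θ φ : Congruence L A) {a c : A}
    (h : Relation.Comp θ.rel φ.rel a c) : Relation.Comp φ.rel θ.rel a c := by
  obtain ⟨b, hab, hbc⟩ := h
  refine ⟨t.realize ![a, b, c], ?_, ?_⟩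
  · have := φ.realize_term_three t (φ.equivalence.refl a) (φ.equivalence.refl b) hbc
    rwa [ht.right] at this
  · have := θ.realize_term_three t hab (θ.equivalence.refl b) (θ.equivalence.refl c)
    rwa [ht.left] at this

theorem comp_comm (ht : IsPixleyTerm t A) (θ φ : Congruence L A) :
    Relation.Comp θ.rel φ.rel = Relation.Comp φ.rel θ.rel := by
  funext a c
  exact propext ⟨ht.comp_le θ φ, ht.comp_le φ θ⟩

/-- Given `a φ b ψ c` and `a θ c`, the element `p = t(a,b,c)` satisfies `a ψ p φ c`, and `a =
t(a,b,a) θ p`; so `p` links `a` to `c` through `θ ⊓ ψ` and `θ ⊓ φ`. -/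
theorem inf_sup_le (ht : IsPixleyTerm t A) (θ φ ψ : Congruence L A) :
    θ ⊓ (φ ⊔ ψ) ≤ (θ ⊓ φ) ⊔ (θ ⊓ ψ) := by
  rintro a c ⟨hθ, hsup⟩
  obtain ⟨b, hab, hbc⟩ := φ.sup_le_comp ψ (ht.comp_comm φ ψ) a c hsup
  have hθ' : θ.rel a (t.realize ![a, b, c]) := by
    have := θ.realize_term_three t (θ.equivalence.refl a) (θ.equivalence.refl b) hθ
    rwa [ht.outer] at this
  have hψ : ψ.rel a (t.realize ![a, b, c]) := by
    have := ψ.realize_term_three t (ψ.equivalence.refl a) (ψ.equivalence.refl b) hbc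
    rwa [ht.right] at this
  have hφ : φ.rel (t.realize ![a, b, c]) c := by
    have := φ.realize_term_three t hab (φ.equivalence.refl b) (φ.equivalence.refl c)
    rwa [ht.left] at this
  have h₁ : θ ⊓ ψ ≤ (θ ⊓ φ) ⊔ (θ ⊓ ψ) := le_sup_right
  have h₂ : θ ⊓ φ ≤ (θ ⊓ φ) ⊔ (θ ⊓ ψ) := le_sup_left
  exact ((θ ⊓ φ) ⊔ (θ ⊓ ψ)).equivalence.trans (h₁ _ _ ⟨hθ', hψ⟩)
    (h₂ _ _ ⟨θ.equivalence.trans (θ.equivalence.symm hθ') hθ, hφ⟩)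

end IsPixleyTerm

theorem isArithmetical_of_pixley {L : FirstOrder.Language.{0, 0}} {𝒱 : Set (Alg.{u} L)}
    (h𝒱 : IsVariety 𝒱) (t : L.Term (Fin 3)) (ht : ∀ A ∈ 𝒱, IsPixleyTerm t A.carrier) :
    IsArithmetical 𝒱 :=
  ⟨h𝒱, fun A hA θ φ ψ => le_antisymm ((ht A hA).inf_sup_le θ φ ψ) le_inf_sup,
    fun A hA => (ht A hA).comp_comm⟩

/-! ### Homomorphisms between algebras -/

section Hom

variable {L : FirstOrder.Language.{0, 0}}

theorem realize_three_hom {A B : Type*} [L.Structure A] [L.Structure B] (h : A →[L] B)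
    (t : L.Term (Fin 3)) (a b c : A) :
    h (t.realize ![a, b, c]) = t.realize ![h a, h b, h c] := by
  rw [← HomClass.realize_term h]
  congr 1
  funext i
  fin_cases i <;> rfl

/-- The projections of a direct product. -/
def Alg.piProj {ι : Type u} (A : ι → Alg.{u} L) (i : ι) :
    (Alg.pi A).carrier →[L] (A i).carrier where
  toFun x := x i
  map_fun' _ _ := rfl
  map_rel' _ _ h := h i

/-- The homomorphism into a direct product with given components. -/
def Alg.piLift [L.IsAlgebraic] {B : Type u} [L.Structure B] {ι : Type u} (A : ι → Alg.{u} L)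
    (h : ∀ i, B →[L] (A i).carrier) : B →[L] (Alg.pi A).carrier where
  toFun x := fun i => h i x
  map_fun' f x := funext fun i => (h i).map_fun f x
  map_rel' r := isEmptyElim r

/-- The canonical homomorphism from the direct product onto a reduced product. -/
def Alg.reducedProductMk [L.IsAlgebraic] {ι : Type u} (F : Filter ι) (A : ι → Alg.{u} L) :
    (Alg.pi A).carrier →[L] (Alg.reducedProduct F A).carrier where
  toFun := Quotient.mk _
  map_fun' f x := (@funMap_quotient_mk' L _ _ (reducedPrestructure F A) _ f x).symm
  map_rel' r := isEmptyElim r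

theorem Alg.reducedProductMk_surjective [L.IsAlgebraic] {ι : Type u} (F : Filter ι)
    (A : ι → Alg.{u} L) : Function.Surjective (Alg.reducedProductMk F A) :=
  Quotient.mk_surjective

/-- The only member of `⊤` is the whole index set, so nothing is identified: direct products count
as reduced products. -/
theorem Alg.reducedProductMk_top_injective [L.IsAlgebraic] {ι : Type u} (A : ι → Alg.{u} L) :
    Function.Injective (Alg.reducedProductMk ⊤ A) := by
  intro x y hxy
  have h : ∀ᶠ i in (⊤ : Filter ι), x i = y i := Quotient.exact hxy
  exact funext (Filter.eventually_top.1 h)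

/-- An injective homomorphism is an isomorphism onto its range. -/
theorem exists_equiv_sub_of_injective [L.IsAlgebraic] {A B : Alg.{u} L}
    (h : A.carrier →[L] B.carrier) (hinj : Function.Injective h) :
    ∃ (S : L.Substructure B.carrier) (hS : (S : Set B.carrier).Nonempty),
      Nonempty ((B.sub S hS).carrier ≃[L] A.carrier) := by
  have hmem : ∀ x, h x ∈ h.range := fun x => ⟨x, rfl⟩
  let e : A.carrier ≃ h.range := Equiv.ofBijective (fun x => (⟨h x, hmem x⟩ : h.range))
    ⟨fun x y hxy => hinj (congrArg Subtype.val hxy), fun ⟨_, x, hx⟩ => ⟨x, Subtype.ext hx⟩⟩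
  let e' : A.carrier ≃[L] h.range :=
    { e with
      map_fun' := fun f x => Subtype.ext (h.map_fun f x)
      map_rel' := fun r => isEmptyElim r }
  exact ⟨h.range, ⟨h (Classical.arbitrary _), hmem _⟩, ⟨e'.symm⟩⟩

theorem IsVariety.of_injective [L.IsAlgebraic] {𝒱 : Set (Alg.{u} L)} (h𝒱 : IsVariety 𝒱)
    {A B : Alg.{u} L} (hB : B ∈ 𝒱) (h : A.carrier →[L] B.carrier)
    (hinj : Function.Injective h) : A ∈ 𝒱 := by
  obtain ⟨S, hS, ⟨e⟩⟩ := exists_equiv_sub_of_injective h hinj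
  exact h𝒱.image _ (h𝒱.sub B hB S hS) A e.toHom e.surjective

theorem IsQuasivariety.of_injective [L.IsAlgebraic] {𝒬 : Set (Alg.{u} L)}
    (h𝒬 : IsQuasivariety 𝒬) {A B : Alg.{u} L} (hB : B ∈ 𝒬) (h : A.carrier →[L] B.carrier)
    (hinj : Function.Injective h) : A ∈ 𝒬 := by
  obtain ⟨S, hS, he⟩ := exists_equiv_sub_of_injective h hinj
  exact h𝒬.iso _ (h𝒬.sub B hB S hS) A he

end Hom

/-! ### The discriminator on `O₃` -/

namespace O3

/-- The value `y` if `x = 0`, and `1/2` otherwise. -/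
def ifZero (x y : O3.{u}) : O3.{u} := imp (imp x (and y (neg y))) y

/-- The value `y` if `x = 1/2`, and `1/2` otherwise. -/
def ifHalf (x y : O3.{u}) : O3.{u} := imp x (imp (neg x) y)

/-- The value `y` if `x = 1`, and `1/2` otherwise. -/
def ifOne (x y : O3.{u}) : O3.{u} := ifZero (neg x) y

/-- The discriminator function of `O₃`, composed from its fundamental operations. -/
def disc (x y z : O3.{u}) : O3.{u} :=
  -- At most one conjunct differs from the neutral value `1/2`. The first line treats `x = y`, the
  -- rest `x ≠ y`; for `x = 1/2 ≠ y` the default is already right.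
  and (and (and (ifZero x (ifZero y z)) (ifHalf x (ifHalf y z))) (ifOne x (ifOne y z)))
    (and (and (ifZero x (ifOne y x)) (ifOne x (ifZero y x)))
      (and (ifZero x (ifHalf y x)) (ifOne x (ifHalf y x))))

theorem disc_self (x z : O3.{u}) : disc x x z = z := by
  cases x <;> cases z <;> rfl

theorem disc_of_ne {x y : O3.{u}} (h : x ≠ y) (z : O3.{u}) : disc x y z = x := by
  cases x <;> cases y <;> first | exact absurd rfl h | (cases z <;> rfl)

/-- The value `z` if `x = y`, and `w` otherwise. -/
def switch (x y z w : O3.{u}) : O3.{u} := disc (disc x y z) (disc x y w) w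

/-- The outer discriminator receives `(z, w, w)`, which gives `z` whether or not `z = w`. -/
theorem switch_self (x z w : O3.{u}) : switch x x z w = z := by
  simp only [switch, disc_self]
  by_cases h : z = w
  · rw [h, disc_self]
  · exact disc_of_ne h w

theorem switch_of_ne {x y : O3.{u}} (h : x ≠ y) (z w : O3.{u}) : switch x y z w = w := by
  simp only [switch, disc_of_ne h, disc_self]

instance : Finite O3.{u} := by
  refine Finite.of_surjective (fun i : Fin 3 => ![zero, half, one] i) fun x => ?_
  cases x
  exacts [⟨0, rfl⟩, ⟨1, rfl⟩, ⟨2, rfl⟩]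

end O3

/-! ### Sets of functions closed under the operations of `O₃` -/

section Closure

variable {X : Type*} {P : (X → O3.{u}) → Prop}

/-- A set of functions into `O₃` closed under the pointwise operations of `O₃`. -/
structure IsClosedUnderOps (P : (X → O3.{u}) → Prop) : Prop where
  -- Disjunction is omitted because the discriminator is built without it.
  and : ∀ {f g}, P f → P g → P fun x => O3.and (f x) (g x)
  imp : ∀ {f g}, P f → P g → P fun x => O3.imp (f x) (g x)
  neg : ∀ {f}, P f → P fun x => O3.neg (f x)

namespace IsClosedUnderOps

theorem ifZero (h : IsClosedUnderOps P) {f g : X → O3.{u}} (hf : P f) (hg : P g) :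
    P fun x => O3.ifZero (f x) (g x) :=
  h.imp (h.imp hf (h.and hg (h.neg hg))) hg

theorem ifHalf (h : IsClosedUnderOps P) {f g : X → O3.{u}} (hf : P f) (hg : P g) :
    P fun x => O3.ifHalf (f x) (g x) :=
  h.imp hf (h.imp (h.neg hf) hg)

theorem ifOne (h : IsClosedUnderOps P) {f g : X → O3.{u}} (hf : P f) (hg : P g) :
    P fun x => O3.ifOne (f x) (g x) :=
  h.ifZero (h.neg hf) hg

theorem disc (h : IsClosedUnderOps P) {f g k : X → O3.{u}} (hf : P f) (hg : P g) (hk : P k) :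
    P fun x => O3.disc (f x) (g x) (k x) :=
  h.and
    (h.and (h.and (h.ifZero hf (h.ifZero hg hk)) (h.ifHalf hf (h.ifHalf hg hk)))
      (h.ifOne hf (h.ifOne hg hk)))
    (h.and (h.and (h.ifZero hf (h.ifOne hg hf)) (h.ifOne hf (h.ifZero hg hf)))
      (h.and (h.ifZero hf (h.ifHalf hg hf)) (h.ifOne hf (h.ifHalf hg hf))))

theorem switch (h : IsClosedUnderOps P) {f g k l : X → O3.{u}} (hf : P f) (hg : P g) (hk : P k)
    (hl : P l) : P fun x => O3.switch (f x) (g x) (k x) (l x) :=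
  h.disc (h.disc hf hg hk) (h.disc hf hg hl) hl

end IsClosedUnderOps

end Closure

/-- The term functions of `O₃` are closed under the operations of `O₃`. -/
theorem isClosedUnderOps_realize (n : ℕ) :
    IsClosedUnderOps fun f : (Fin n → O3.{u}) → O3.{u} =>
      ∃ t : olLang.Term (Fin n), ∀ x, t.realize x = f x where
  and := by
    rintro f g ⟨s, hs⟩ ⟨t, ht⟩
    exact ⟨Term.func (L := olLang) (l := 2) OLOp.and ![s, t], fun x =>
      congrArg₂ O3.and (hs x) (ht x)⟩
  imp := by
    rintro f g ⟨s, hs⟩ ⟨t, ht⟩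
    exact ⟨Term.func (L := olLang) (l := 2) OLOp.imp ![s, t], fun x =>
      congrArg₂ O3.imp (hs x) (ht x)⟩
  neg := by
    rintro f ⟨s, hs⟩
    exact ⟨Term.func (L := olLang) (l := 1) OLOp.neg ![s], fun x =>
      congrArg O3.neg (hs x)⟩

theorem exists_discTerm : ∃ t : olLang.Term (Fin 3),
    ∀ a b c : O3.{u}, t.realize ![a, b, c] = O3.disc a b c := by
  obtain ⟨t, ht⟩ := (isClosedUnderOps_realize.{u} 3).disc (f := fun x => x 0)
    (g := fun x => x 1) (k := fun x => x 2) ⟨Term.var 0, fun _ => rfl⟩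
    ⟨Term.var 1, fun _ => rfl⟩ ⟨Term.var 2, fun _ => rfl⟩
  exact ⟨t, fun a b c => ht ![a, b, c]⟩

/-- A discriminator term of `O₃`. -/
noncomputable def discTerm : olLang.Term (Fin 3) := exists_discTerm.{u}.choose

theorem realize_discTerm (a b c : O3.{u}) :
    discTerm.{u}.realize ![a, b, c] = O3.disc a b c :=
  exists_discTerm.{u}.choose_spec a b c

theorem isDiscriminatorTerm_discTerm : IsDiscriminatorTerm algO3.{u} discTerm.{u} := by
  intro a b c
  refine ⟨?_, fun h => (realize_discTerm a b c).trans (O3.disc_of_ne h c)⟩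
  rintro rfl
  exact (realize_discTerm a a c).trans (O3.disc_self a c)

theorem isQuasiprimal_algO3 : IsQuasiprimal algO3.{u} :=
  ⟨inferInstanceAs (Finite O3.{u}), discTerm.{u}, isDiscriminatorTerm_discTerm⟩

/-! ### Algebras separated by their homomorphisms into `O₃` -/

/-- The class of algebras whose homomorphisms into `O₃` separate points. -/
def separatedClass : Set (Alg.{u} olLang) :=
  {A | ∀ a b : A.carrier, (∀ h : A.carrier →[olLang] O3.{u}, h a = h b) → a = b}

theorem isPixleyTerm_of_mem {A : Alg.{u} olLang} (hA : A ∈ separatedClass) :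
    IsPixleyTerm discTerm.{u} A.carrier where
  left a c := hA _ _ fun h => by
    rw [realize_three_hom, realize_discTerm, O3.disc_self]
  right a b := hA _ _ fun h => by
    rw [realize_three_hom, realize_discTerm]
    by_cases e : h a = h b
    · rw [e, O3.disc_self]
    · rw [O3.disc_of_ne e]
  outer a b := hA _ _ fun h => by
    rw [realize_three_hom, realize_discTerm]
    by_cases e : h a = h b
    · rw [e, O3.disc_self]
    · rw [O3.disc_of_ne e]

section Switch

variable {A B : Type u} [olLang.Structure A] [olLang.Structure B]

/-- The term operation of an algebra that induces `O3.switch` on `O₃`. -/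
noncomputable def switchOp (x y z w : A) : A :=
  discTerm.{u}.realize
    ![discTerm.{u}.realize ![x, y, z], discTerm.{u}.realize ![x, y, w], w]

theorem map_switchOp (h : A →[olLang] B) (x y z w : A) :
    h (switchOp x y z w) = switchOp (h x) (h y) (h z) (h w) := by
  simp only [switchOp, realize_three_hom]

theorem switchOp_O3 (x y z w : O3.{u}) : switchOp x y z w = O3.switch x y z w := by
  simp only [switchOp, realize_discTerm, O3.switch]

end Switch

theorem switchOp_self {A : Alg.{u} olLang} (hA : A ∈ separatedClass) (x z w : A.carrier) :
    switchOp x x z w = z :=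
  hA _ _ fun h => by rw [map_switchOp, switchOp_O3, O3.switch_self]

/-! ### Limits of homomorphisms along ultrafilters -/

section Limit

variable {A : Type u} [olLang.Structure A]

theorem exists_eventually_eq (U : Ultrafilter (A →[olLang] O3.{u})) (x : A) :
    ∃ v : O3.{u}, ∀ᶠ h in (U : Filter (A →[olLang] O3.{u})), h x = v := by
  have hx : ∀ᶠ h in (U : Filter (A →[olLang] O3.{u})),
      h x = O3.zero ∨ h x = O3.half ∨ h x = O3.one :=
    Filter.Eventually.of_forall fun h => by cases h x <;> simp
  rcases Ultrafilter.eventually_or.1 hx with hx | hx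
  · exact ⟨_, hx⟩
  · rcases Ultrafilter.eventually_or.1 hx with hx | hx
    exacts [⟨_, hx⟩, ⟨_, hx⟩]

/-- The limit of the homomorphisms into `O₃` along an ultrafilter. -/
noncomputable def limHom (U : Ultrafilter (A →[olLang] O3.{u})) : A →[olLang] O3.{u} where
  toFun x := (exists_eventually_eq U x).choose
  map_fun' f x := by
    -- Arities are finite, so a single `h` agrees with the limit at all arguments and at the value.
    have h₁ := Filter.eventually_all.2 fun k => (exists_eventually_eq U (x k)).choose_spec
    obtain ⟨h, h₁, h₂⟩ :=
      (h₁.and (exists_eventually_eq U (Structure.funMap f x)).choose_spec).exists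
    rw [← h₂, h.map_fun]
    exact congrArg _ (funext h₁)
  map_rel' r := isEmptyElim r

theorem eventually_eq_limHom (U : Ultrafilter (A →[olLang] O3.{u})) (x : A) :
    ∀ᶠ h in (U : Filter (A →[olLang] O3.{u})), h x = limHom U x :=
  (exists_eventually_eq U x).choose_spec

theorem limHom_eq_iff (U : Ultrafilter (A →[olLang] O3.{u})) (x y : A) :
    limHom U x = limHom U y ↔ ∀ᶠ h in (U : Filter (A →[olLang] O3.{u})), h x = h y := by
  have hxy := (eventually_eq_limHom U x).and (eventually_eq_limHom U y)
  constructor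
  · intro e
    exact hxy.mono fun h hh => by rw [hh.1, hh.2, e]
  · intro e
    obtain ⟨h, ⟨h₁, h₂⟩, h₃⟩ := (hxy.and e).exists
    rw [← h₁, ← h₂, h₃]

end Limit

/-! ### Closure under homomorphic images -/

section Image

variable {A B : Alg.{u} olLang} (f : A.carrier →[olLang] B.carrier)

/-- The filter of sets of homomorphisms into `O₃` that contain the equalizer of a pair in the
kernel of `f`. -/
def kerFilter (hA : A ∈ separatedClass) : Filter (A.carrier →[olLang] O3.{u}) where
  sets := {s | ∃ x y, f x = f y ∧ ∀ h : A.carrier →[olLang] O3.{u}, h x = h y → h ∈ s}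
  univ_sets := ⟨Classical.arbitrary _, _, rfl, fun _ _ => trivial⟩
  sets_of_superset := by
    rintro s s' ⟨x, y, hxy, hs⟩ hss
    exact ⟨x, y, hxy, fun h hh => hss (hs h hh)⟩
  inter_sets := by
    rintro s s' ⟨x, y, hxy, hs⟩ ⟨x', y', hxy', hs'⟩
    -- Where `h x = h y` the new pair has values `h x'`, `h y'`; elsewhere it has the distinct
    -- values `h x`, `h y`. So its equalizer is the intersection of the two. Under `f`, where `x`
    -- and `y` agree, it becomes `f x'`, `f y'`.
    refine ⟨switchOp x y x' x, switchOp x y y' y, ?_, fun h hh => ?_⟩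
    · have h₁ : f (switchOp x y x' x) = f (switchOp x x x' x) := by
        rw [map_switchOp, map_switchOp, hxy]
      have h₂ : f (switchOp x y y' y) = f (switchOp x x y' y) := by
        rw [map_switchOp, map_switchOp, hxy]
      rw [h₁, h₂, switchOp_self hA, switchOp_self hA, hxy']
    · rw [map_switchOp, map_switchOp, switchOp_O3, switchOp_O3] at hh
      by_cases e : h x = h y
      · rw [e, O3.switch_self, O3.switch_self] at hh
        exact ⟨hs h e, hs' h hh⟩
      · rw [O3.switch_of_ne e, O3.switch_of_ne e] at hh
        exact absurd hh e

variable {f}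

/-- If the equalizer of a kernel pair `x, y` lies in that of `a, b`, then `switchOp x y a b = b` in
`A`, as every homomorphism into `O₃` confirms; but `f` sends it to `f a`, since `f x = f y`. -/
theorem eventually_kerFilter_iff (hA : A ∈ separatedClass) (a b : A.carrier) :
    (∀ᶠ h in kerFilter f hA, h a = h b) ↔ f a = f b := by
  refine ⟨?_, fun e => ⟨a, b, e, fun _ hh => hh⟩⟩
  rintro ⟨x, y, hxy, hs⟩
  have h₁ : switchOp x y a b = b := hA _ _ fun h => by
    rw [map_switchOp, switchOp_O3]
    by_cases e : h x = h y
    · rw [e, O3.switch_self]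
      exact hs h e
    · rw [O3.switch_of_ne e]
  have h₂ : f (switchOp x y a b) = f (switchOp x x a b) := by
    rw [map_switchOp, map_switchOp, hxy]
  rw [switchOp_self hA, h₁] at h₂
  exact h₂.symm

theorem mem_separatedClass_of_surjective (hA : A ∈ separatedClass)
    (hf : Function.Surjective f) : B ∈ separatedClass := by
  intro a b hab
  obtain ⟨a, rfl⟩ := hf a
  obtain ⟨b, rfl⟩ := hf b
  rw [← eventually_kerFilter_iff hA]
  by_contra hfreq
  rw [Filter.not_eventually] at hfreq
  have hne : (kerFilter f hA ⊓ Filter.principal {h | ¬ h a = h b}).NeBot :=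
    Filter.frequently_mem_iff_neBot.1 hfreq
  let U := Ultrafilter.of (kerFilter f hA ⊓ Filter.principal {h | ¬ h a = h b})
  have hU : (U : Filter _) ≤ kerFilter f hA ⊓ Filter.principal {h | ¬ h a = h b} :=
    Ultrafilter.of_le _
  -- The limit identifies every kernel pair of `f`, so it descends to `B`, independently of the
  -- chosen preimages.
  have hker : ∀ x y, f x = f y → limHom U x = limHom U y := fun x y e =>
    (limHom_eq_iff U x y).2 ((hU.trans inf_le_left) ((eventually_kerFilter_iff hA x y).2 e))
  let g : B.carrier →[olLang] O3.{u} :=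
    { toFun := fun z => limHom U (Function.surjInv hf z)
      map_fun' := fun k x => by
        refine (hker _ (Structure.funMap k fun i => Function.surjInv hf (x i)) ?_).trans
          ((limHom U).map_fun k _)
        rw [f.map_fun, Function.surjInv_eq hf]
        exact congrArg _ (funext fun i => (Function.surjInv_eq hf (x i)).symm)
      map_rel' := fun r => isEmptyElim r }
  have hg : ∀ x, g (f x) = limHom U x := fun x => hker _ _ (Function.surjInv_eq hf _)
  have hlim : limHom U a = limHom U b := by rw [← hg, ← hg, hab]
  have hmem : ∀ᶠ h : A.carrier →[olLang] O3.{u} in U, ¬ h a = h b :=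
    Filter.le_principal_iff.1 (hU.trans inf_le_right)
  obtain ⟨h, h₁, h₂⟩ := (hmem.and ((limHom_eq_iff U a b).1 hlim)).exists
  exact h₁ h₂

end Image

/-! ### The separated class as generated variety and quasivariety -/

theorem algO3_mem_separatedClass : algO3.{u} ∈ separatedClass.{u} :=
  fun _ _ h => h (Hom.id olLang O3.{u})

theorem isVariety_separatedClass : IsVariety separatedClass.{u} where
  nonempty := ⟨_, algO3_mem_separatedClass⟩
  image _ hA _ _ hf := mem_separatedClass_of_surjective hA hf
  sub _ hA S _ _ _ hab :=
    Subtype.ext (hA _ _ fun h => hab (h.comp S.subtype.toHom))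
  pi _ A hA _ _ hab :=
    funext fun i => hA i _ _ fun h => hab (h.comp (Alg.piProj A i))

theorem isQuasivariety_separatedClass : IsQuasivariety separatedClass.{u} where
  trivial _ _ _ _ _ := Subsingleton.elim _ _
  iso _ hA _ := fun ⟨e⟩ => mem_separatedClass_of_surjective (f := e.toHom) hA e.surjective
  sub := isVariety_separatedClass.sub
  reducedProduct ι F A hA := mem_separatedClass_of_surjective
    (isVariety_separatedClass.pi ι A hA) (Alg.reducedProductMk_surjective F A)

/-- The evaluation homomorphism into the power of `O₃` indexed by the homomorphisms. -/
def evalHom (A : Alg.{u} olLang) :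
    A.carrier →[olLang] (Alg.pi fun _ : A.carrier →[olLang] O3.{u} => algO3.{u}).carrier :=
  Alg.piLift _ fun h => h

theorem evalHom_injective {A : Alg.{u} olLang} (hA : A ∈ separatedClass) :
    Function.Injective (evalHom A) :=
  fun a b hab => hA a b fun h => congrFun hab h

theorem varietyO3_eq : varietyO3.{u} = separatedClass.{u} := by
  refine Set.Subset.antisymm (fun A hA => hA _ isVariety_separatedClass ?_) ?_
  · exact Set.singleton_subset_iff.2 algO3_mem_separatedClass
  · intro A hA 𝒱 h𝒱 hK
    exact h𝒱.of_injective (h𝒱.pi _ _ fun _ => hK rfl) (evalHom A) (evalHom_injective hA)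

theorem OL_eq : OL.{u} = separatedClass.{u} := by
  refine Set.Subset.antisymm (fun A hA => hA _ isQuasivariety_separatedClass ?_) ?_
  · exact Set.singleton_subset_iff.2 algO3_mem_separatedClass
  · intro A hA 𝒬 h𝒬 hK
    exact h𝒬.of_injective (h𝒬.reducedProduct _ ⊤ _ fun _ => hK rfl)
      ((Alg.reducedProductMk ⊤ _).comp (evalHom A))
      ((Alg.reducedProductMk_top_injective _).comp (evalHom_injective hA))

theorem isArithmetical_separatedClass : IsArithmetical separatedClass.{u} :=
  isArithmetical_of_pixley isVariety_separatedClass discTerm.{u} fun _ hA =>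
    isPixleyTerm_of_mem hA

/-! ### Primality of the expansions by a constant -/

/-- The term functions of `O₃` with an additional constant. -/
def ConstTermFun (c : O3.{u}) (n : ℕ) (f : (Fin n → O3.{u}) → O3.{u}) : Prop :=
  ∃ t : (olLang[[Unit]]).Term (Fin n),
    ∀ x : Fin n → (algO3WithConstant c).carrier, t.realize x = f x

namespace ConstTermFun

variable {c : O3.{u}} {n : ℕ}

theorem isClosedUnderOps (c : O3.{u}) (n : ℕ) : IsClosedUnderOps (ConstTermFun c n) where
  and := by
    rintro f g ⟨s, hs⟩ ⟨t, ht⟩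
    exact ⟨Term.func (L := olLang[[Unit]]) (l := 2) (Sum.inl OLOp.and) ![s, t], fun x =>
      congrArg₂ O3.and (hs x) (ht x)⟩
  imp := by
    rintro f g ⟨s, hs⟩ ⟨t, ht⟩
    exact ⟨Term.func (L := olLang[[Unit]]) (l := 2) (Sum.inl OLOp.imp) ![s, t], fun x =>
      congrArg₂ O3.imp (hs x) (ht x)⟩
  neg := by
    rintro f ⟨s, hs⟩
    exact ⟨Term.func (L := olLang[[Unit]]) (l := 1) (Sum.inl OLOp.neg) ![s], fun x =>
      congrArg O3.neg (hs x)⟩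

theorem proj (c : O3.{u}) (i : Fin n) : ConstTermFun c n fun x => x i :=
  ⟨Term.var i, fun _ => rfl⟩

theorem self (c : O3.{u}) (n : ℕ) : ConstTermFun c n fun _ => c :=
  ⟨Term.func (L := olLang[[Unit]]) (l := 0) (Sum.inr (() : Unit)) ![], fun _ => rfl⟩

/-- For `c` in `{0, 1}`, `c` and `¬c` are the two classical values, and `(c ∧ ¬c) → c` is `0 → c =
1/2`. -/
theorem const (hc : c ≠ O3.half) (n : ℕ) (d : O3.{u}) : ConstTermFun c n fun _ => d := by
  have H := isClosedUnderOps c n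
  have h := self c n
  have hn := H.neg h
  have hi := H.imp (H.and h hn) h
  cases c <;> cases d <;> first | exact absurd rfl hc | exact h | exact hn | exact hi

theorem comp_succ {f : (Fin n → O3.{u}) → O3.{u}} (hf : ConstTermFun c n f) :
    ConstTermFun c (n + 1) fun x => f fun i => x i.succ := by
  obtain ⟨t, ht⟩ := hf
  refine ⟨t.relabel Fin.succ, fun x => ?_⟩
  rw [Term.realize_relabel]
  exact ht _

theorem all (hc : c ≠ O3.half) : ∀ (n : ℕ) (f : (Fin n → O3.{u}) → O3.{u}), ConstTermFun c n f
  | 0, f => by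
    convert const hc 0 (f ![]) using 3
  | n + 1, f => by
    have hrec : ∀ d : O3.{u}, ConstTermFun c (n + 1) fun x => f (Fin.cons d fun i => x i.succ) :=
      fun d => (all hc n fun x => f (Fin.cons d x)).comp_succ
    have H := isClosedUnderOps c (n + 1)
    -- Case distinction on the first argument: `0`, then `1`, otherwise `1/2`; each branch is a
    -- function of the remaining arguments.
    convert H.switch (proj c 0) (const hc _ O3.zero) (hrec O3.zero)
      (H.switch (proj c 0) (const hc _ O3.one) (hrec O3.one) (hrec O3.half)) using 2 with x
    have hx : x = Fin.cons (x 0) fun i => x i.succ := (Fin.cons_self_tail x).symm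
    generalize (fun i : Fin n => x i.succ) = y at hx ⊢
    generalize x 0 = d at hx ⊢
    subst hx
    cases d
    · rw [O3.switch_self]
    · rw [O3.switch_of_ne (by simp), O3.switch_of_ne (by simp)]
    · rw [O3.switch_of_ne (by simp), O3.switch_self]

end ConstTermFun

theorem isPrimal_algO3WithConstant {c : O3.{u}} (hc : c ≠ O3.half) :
    IsPrimal (algO3WithConstant c) :=
  ⟨inferInstanceAs (Finite O3.{u}), fun n _ f => ConstTermFun.all hc n f⟩

end OrdinaryDiscourse

theorem mainTheorem7 :
    OrdinaryDiscourse.IsArithmetical OrdinaryDiscourse.varietyO3.{u} ∧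
    OrdinaryDiscourse.varietyO3.{u} = OrdinaryDiscourse.OL.{u} ∧
    (OrdinaryDiscourse.IsQuasiprimal OrdinaryDiscourse.algO3.{u} ∧
      OrdinaryDiscourse.IsDiscriminatorVariety OrdinaryDiscourse.OL.{u}) ∧
    (OrdinaryDiscourse.IsPrimal
        (OrdinaryDiscourse.algO3WithConstant.{u} OrdinaryDiscourse.O3.zero) ∧
      OrdinaryDiscourse.IsPrimal
        (OrdinaryDiscourse.algO3WithConstant.{u} OrdinaryDiscourse.O3.one)) := by
  have hV := OrdinaryDiscourse.varietyO3_eq.{u}.trans OrdinaryDiscourse.OL_eq.symm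
  refine ⟨?_, hV, ⟨OrdinaryDiscourse.isQuasiprimal_algO3, {OrdinaryDiscourse.algO3},
      OrdinaryDiscourse.discTerm.{u}, ?_, hV.symm⟩,
    OrdinaryDiscourse.isPrimal_algO3WithConstant (by simp),
    OrdinaryDiscourse.isPrimal_algO3WithConstant (by simp)⟩
  · rw [OrdinaryDiscourse.varietyO3_eq]
    exact OrdinaryDiscourse.isArithmetical_separatedClass
  · rintro A rfl
    exact OrdinaryDiscourse.isDiscriminatorTerm_discTerm
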